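/- Let $n\ge 1$ be a number of offline nodes. A request sequence is a non-empty finite sequence $E=((N_t,q_t))_{t=1}^m$ ($m\ge 1$ arbitrary) of non-empty sets $N_t\subseteq[n]=\{1,\dots,n\}$ and quantities $q_t>0$. A feasible allocation of the online node $t$ is an $x_t\in\mathbb{R}_{\ge 0}^n$ with $x_t(i)=0$ for $i\notin N_t$ and $\sum_i x_t(i)=q_t$, and $\Delta(E)$ is the set of all sums $\sum_t x_t$ of feasible allocations. An online policy $\mathcal{A}$ (possibly randomized) maps the current node and the history of arrivals and decisions to a feasible allocation of the current node; $\mathcal{A}(E)=\sum_t x_t$ is its (random) final load vector on $E$. The water-filling policy $\mathrm{WF}$ is the deterministic policy that, with current loads $\ell_{t-1}=\sum_{s<t}x_s$, chooses the feasible $x_t$ that maximizes $\min_{i\in N_t}\{x_t(i)+\ell_{t-1}(i)\}$. For $f:\mathbb{R}_{\ge0}^n\to\mathbb{R}_{\ge0}$ and $\alpha>0$ the $\alpha$-regret of $\mathcal{A}$ is $$\mathrm{Reg}_{\alpha,f}(\mathcal{A})=\sup_{E}\Big(\alpha\max_{\ell\in\Delta(E)}f(\ell)-\mathbb{E}[f(\mathcal{A}(E))]\Big),$$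 the supremum being over all (fixed in advance) request sequences on $n$ offline nodes, and the competitive ratio of $\mathcal{A}$ for maximizing $f$ is the largest $\alpha>0$ with $\mathrm{Reg}_{\alpha,f}(\mathcal{A})\le 0$. Let $c>0$ and $\mathrm{FM}_c(x)=\sum_{i=1}^n\min(c,x(i))$. Let $H_k=\sum_{i=1}^k 1/i$ (with $H_0=0$) and $M_k=\frac1k\sum_{i=0}^{k}\min(1,H_k-H_i)$ for $k\ge1$. Then the competitive ratio of $\mathrm{WF}$ for maximizing $\mathrm{FM}_c$ is exactly $\min_{1\le k\le n}M_k$, and it is minimax optimal: whenever $\mathcal{A}$ is a (possibly randomized) policy and $\alpha>0$ satisfies $\mathrm{Reg}_{\alpha,\mathrm{FM}_c}(\mathcal{A})\le0$, then $\alpha\le\min_{1\le k\le n}M_k$, so no policy has a larger competitive ratio. -/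

import Mathlib

open scoped Pointwise

/-- An online node for `n` offline nodes: a non-empty set of compatible offline nodes and a
positive divisible quantity. -/
structure Request (n : ℕ) where
  nbrs : Finset (Fin n)
  nonempty : nbrs.Nonempty
  quantity : ℝ
  quantity_pos : 0 < quantity

/-- The feasible allocations of one online node: nonnegative, supported on the compatible offline
nodes, and distributing the whole quantity. -/
def Request.feasible {n : ℕ} (r : Request n) : Set (Fin n → ℝ) :=
  {x | (∀ i, 0 ≤ x i) ∧ (∀ i, i ∉ r.nbrs → x i = 0) ∧ ∑ i, x i = r.quantity}

/-- The feasible load vectors of a request sequence: the Minkowski sum of the sets of feasible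
allocations of its online nodes. -/
def feasibleLoads {n : ℕ} (E : List (Request n)) : Set (Fin n → ℝ) :=
  (E.map Request.feasible).sum

/-- The past arrivals, each with the allocation that was chosen for it, oldest first. -/
abbrev History (n : ℕ) := List (Request n × (Fin n → ℝ))

/-- The load vector accumulated over a history. -/
def History.load {n : ℕ} (h : History n) : Fin n → ℝ :=
  (h.map Prod.snd).sum

/-- A deterministic online allocation policy: it maps the history of arrivals and decisions and the
current online node to a feasible allocation of that node. -/
structure Policy (n : ℕ) where
  alloc : History n → Request n → Fin n → ℝ
  alloc_feasible : ∀ h r, alloc h r ∈ r.feasible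

/-- The total allocation made by a policy on the arrivals `E` if they follow the history `h`. -/
def Policy.loadFrom {n : ℕ} (A : Policy n) : History n → List (Request n) → Fin n → ℝ
  | _, [] => 0
  | h, r :: E => A.alloc h r + A.loadFrom (h ++ [(r, A.alloc h r)]) E

/-- The final load vector of a policy on the request sequence `E`. -/
def Policy.load {n : ℕ} (A : Policy n) (E : List (Request n)) : Fin n → ℝ :=
  A.loadFrom [] E

/-- A randomized policy: the random coins `ω` are drawn from a probability space, and
`policy ω` is the online policy that is followed with these coins. A fixed request sequence
then has a random final load vector. -/
structure RandomizedPolicy (n : ℕ) where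
  Coins : Type*
  [measurableSpace : MeasurableSpace Coins]
  law : MeasureTheory.Measure Coins
  [isProbabilityMeasure : MeasureTheory.IsProbabilityMeasure law]
  policy : Coins → Policy n
  measurable_load : ∀ E : List (Request n), Measurable fun ω => (policy ω).load E

attribute [instance] RandomizedPolicy.measurableSpace RandomizedPolicy.isProbabilityMeasure

/-- A deterministic policy, as a randomized policy without coins. -/
noncomputable def Policy.toRandomized {n : ℕ} (A : Policy n) : RandomizedPolicy n where
  Coins := Unit
  law := MeasureTheory.Measure.dirac ()
  policy := fun _ => A
  measurable_load := fun _ => measurable_const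

/-- The least load among the compatible offline nodes of `r`, if the loads were `l` before and `r`
is allocated as `x`. -/
noncomputable def Request.minLoad {n : ℕ} (r : Request n) (l x : Fin n → ℝ) : ℝ :=
  r.nbrs.inf' r.nonempty fun i => x i + l i

/-- `x` is a water-filling allocation of `r` at the load vector `l`: it maximizes, over the feasible
allocations, the least load among the compatible offline nodes. -/
def Request.IsWaterFilling {n : ℕ} (r : Request n) (l x : Fin n → ℝ) : Prop :=
  x ∈ r.feasible ∧ IsMaxOn (r.minLoad l) r.feasible x

theorem Request.exists_isWaterFilling {n : ℕ} (r : Request n) (l : Fin n → ℝ) :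
    ∃ x, r.IsWaterFilling l x := by
  have hne : r.feasible.Nonempty := by
    obtain ⟨i, hi⟩ := r.nonempty
    refine ⟨Pi.single i r.quantity, fun j => ?_, fun j hj => ?_, ?_⟩
    · by_cases h : j = i
      · subst h; simpa using r.quantity_pos.le
      · simp [h]
    · have h : j ≠ i := by rintro rfl; exact hj hi
      simp [h]
    · simp
  have hcl : IsClosed r.feasible := by
    have h1 : IsClosed {x : Fin n → ℝ | ∀ i, 0 ≤ x i} := by
      simp only [Set.ofPred_forall]
      exact isClosed_iInter fun i => isClosed_le continuous_const (continuous_apply i)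
    have h2 : IsClosed {x : Fin n → ℝ | ∀ i, i ∉ r.nbrs → x i = 0} := by
      simp only [Set.ofPred_forall]
      exact isClosed_iInter fun i => isClosed_iInter fun _ =>
        isClosed_eq (continuous_apply i) continuous_const
    have h3 : IsClosed {x : Fin n → ℝ | ∑ i, x i = r.quantity} :=
      isClosed_eq (by fun_prop) continuous_const
    exact h1.inter (h2.inter h3)
  have hsub : r.feasible ⊆ Set.Icc 0 (fun _ => r.quantity) := by
    rintro x ⟨h0, -, hs⟩
    refine ⟨h0, fun i => ?_⟩
    simpa [hs] using Finset.single_le_sum (f := x) (fun j _ => h0 j) (Finset.mem_univ i)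
  have hcomp : IsCompact r.feasible := isCompact_Icc.of_isClosed_subset hcl hsub
  have hcont : Continuous (r.minLoad l) := by
    unfold Request.minLoad
    exact Continuous.finset_inf'_apply r.nonempty fun i _ => by fun_prop
  obtain ⟨x, hx, hm⟩ := hcomp.exists_isMaxOn hne hcont.continuousOn
  exact ⟨x, hx, hm⟩

/-- The water-filling policy. (The maximizer that it selects is unique.) -/
noncomputable def waterFilling (n : ℕ) : Policy n where
  alloc := fun h r => Classical.choose (r.exists_isWaterFilling h.load)
  alloc_feasible := fun h r => (Classical.choose_spec (r.exists_isWaterFilling h.load)).1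

/-- The optimal value in hindsight of the objective `f` on `E`. (The set of feasible load vectors is
compact and non-empty, so this is an attained maximum for continuous `f`.) -/
noncomputable def hindsightValue {n : ℕ} (f : (Fin n → ℝ) → ℝ) (E : List (Request n)) : ℝ :=
  sSup (f '' feasibleLoads E)

/-- The cost of a randomized policy on a fixed request sequence, for maximization of `f` with
comparison factor `α`. -/
noncomputable def RandomizedPolicy.cost {n : ℕ} (A : RandomizedPolicy n)
    (f : (Fin n → ℝ) → ℝ) (α : ℝ) (E : List (Request n)) : ℝ :=
  α * hindsightValue f E - ∫ ω, f ((A.policy ω).load E) ∂A.law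

/-- The worst-case `α`-regret for maximization of `f`, over all (oblivious) request sequences with
any positive number of online nodes and any quantities; it may be `⊤`. -/
noncomputable def RandomizedPolicy.regret {n : ℕ} (A : RandomizedPolicy n)
    (f : (Fin n → ℝ) → ℝ) (α : ℝ) : EReal :=
  ⨆ (E : List (Request n)) (_ : E ≠ []), (A.cost f α E : EReal)

/-- The positive factors `α` such that `A` is `α`-competitive for maximization of `f`. -/
def RandomizedPolicy.competitiveFactors {n : ℕ} (A : RandomizedPolicy n)
    (f : (Fin n → ℝ) → ℝ) : Set ℝ :=
  {α | 0 < α ∧ A.regret f α ≤ 0}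

/-- `ρ` is the competitive ratio of `A` for maximization of `f`. -/
def RandomizedPolicy.IsCompetitiveRatio {n : ℕ} (A : RandomizedPolicy n)
    (f : (Fin n → ℝ) → ℝ) (ρ : ℝ) : Prop :=
  IsGreatest (A.competitiveFactors f) ρ

/-- The fractional matching objective with capacity `c`. -/
noncomputable def fractionalMatching {n : ℕ} (c : ℝ) (x : Fin n → ℝ) : ℝ :=
  ∑ i, min c (x i)

/-- The fractional matching sequence `M_k`; `harmonic k` is `1 + 1/2 + ... + 1/k`. -/
noncomputable def matchingSeq (k : ℕ) : ℝ :=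
  (1 / (k : ℝ)) * ∑ i ∈ Finset.range (k + 1), min 1 ((harmonic k : ℝ) - (harmonic i : ℝ))

/-! Lower bound. Scale to c = 1; let L be the water-filling load and T the truncated total of a
competing allocation y. A request that can use a node whose final level is at most b is poured
entirely below b, so y places at most ∑ min(b, L i) on the nodes with L i ≤ b
(`waterFilling_sum_le`); every other node adds at most 1 to T. Hence R(b) = T - ∑ min(b, L i) is at
most #{i | b < L i}, the rate at which R decreases. As this rate is an integer, R lies below the
solution of u' = -⌈u⌉, u(0) = T, which is `harmonicInv` run backwards: its slope is k on [H_{k-1},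
H_k] for k ≤ n (`sub_sum_min_le_harmonicInv`). At b = 1, water-filling earns at least an increment
of `harmonicInv` over a unit interval. At the right endpoint H_k that increment is k * M_k, and
concavity covers the endpoints in between (`le_harmonicInv_sub`).

Upper bound. In a randomly ordered upper triangular instance a policy cannot distinguish the nodes
still available, so on average they share each request equally. Jensen's inequality bounds the mean
value by c * k * M_k, whereas hindsight earns k * c. -/

/-! ### Levels reached by water-filling -/

theorem Request.IsWaterFilling.load_le {n : ℕ} {r : Request n} {l x : Fin n → ℝ}
    (h : r.IsWaterFilling l x) {i j : Fin n} (hi : i ∈ r.nbrs) (hj : 0 < x j) :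
    x j + l j ≤ x i + l i := by
  obtain ⟨⟨h0, hz, hs⟩, hmax⟩ := h
  have hjn : j ∈ r.nbrs := by
    by_contra hjn
    exact hj.ne' (hz j hjn)
  by_contra! hlt
  have hcard : (0 : ℝ) < r.nbrs.card := by exact_mod_cast r.nonempty.card_pos
  set w := r.minLoad l x with hw
  have hwle : ∀ a ∈ r.nbrs, w ≤ x a + l a := fun a ha => Finset.inf'_le _ ha
  have hwj : w < x j + l j := (hwle i hi).trans_lt hlt
  -- If j ends above the minimum level w, taking ε from j and spreading it equally over all
  -- neighbours, j included, lifts every level strictly above w.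
  set ε := min (x j) (x j + l j - w) with hε
  have hεpos : 0 < ε := lt_min hj (by linarith)
  have hε1 : ε ≤ x j := min_le_left _ _
  have hε2 : ε ≤ x j + l j - w := min_le_right _ _
  have hd : 0 < ε / r.nbrs.card := div_pos hεpos hcard
  let x' : Fin n → ℝ := fun a =>
    x a + (if a ∈ r.nbrs then ε / r.nbrs.card else 0) - (if a = j then ε else 0)
  have hx' : x' ∈ r.feasible := by
    refine ⟨fun a => ?_, fun a ha => ?_, ?_⟩
    · have := h0 a
      by_cases haj : a = j
      · subst haj
        simp only [x', hjn, if_true]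
        linarith
      · simp only [x', haj, if_false]
        split_ifs <;> linarith
    · have haj : a ≠ j := by rintro rfl; exact ha hjn
      simp [x', ha, haj, hz a ha]
    · simp only [x', Finset.sum_sub_distrib, Finset.sum_add_distrib, Finset.sum_ite_mem,
        Finset.sum_ite_eq', Finset.univ_inter, Finset.sum_const, nsmul_eq_mul, hs,
        Finset.mem_univ, if_true]
      field_simp
      ring
  have hgt : w < r.minLoad l x' := by
    refine (Finset.lt_inf'_iff _).2 fun a ha => ?_
    have := hwle a ha
    by_cases haj : a = j
    · subst haj
      simp only [x', hjn, if_true]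
      linarith
    · simp only [x', haj, ha, if_false, if_true]
      linarith
  exact absurd (hmax hx') (not_le.2 hgt)

/-- The requests that touch a set of nodes of low load are allocated below that load. -/
theorem Request.IsWaterFilling.sum_le {n : ℕ} {r : Request n} {l x y : Fin n → ℝ}
    (h : r.IsWaterFilling l x) (hy : y ∈ r.feasible) (S : Finset (Fin n)) (b : ℝ)
    (hS : ∀ i ∈ S, l i + x i ≤ b) :
    ∑ i ∈ S, y i ≤ ∑ i, (min b (l i + x i) - min b (l i)) := by
  by_cases hdisj : ∃ i ∈ S, i ∈ r.nbrs
  · obtain ⟨i, hiS, hir⟩ := hdisj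
    -- Every node that receives something ends no higher than i, hence at most at b: truncation at b
    -- loses nothing.
    have hx : ∀ j, min b (l j + x j) - min b (l j) = x j := by
      intro j
      rcases (h.1.1 j).eq_or_lt with hj | hj
      · simp [← hj]
      · have h1 := h.load_le hir hj
        have h2 := hS i hiS
        rw [min_eq_right (by linarith), min_eq_right (by linarith)]
        ring
    rw [Finset.sum_congr rfl fun j _ => hx j, h.1.2.2, ← hy.2.2]
    exact Finset.sum_le_univ_sum_of_nonneg hy.1
  · push Not at hdisj
    rw [Finset.sum_eq_zero fun i hi => hy.2.1 i (hdisj i hi)]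
    refine Finset.sum_nonneg fun i _ => sub_nonneg.2 (min_le_min_left _ ?_)
    linarith [h.1.1 i]

theorem History.load_append_singleton {n : ℕ} (h : History n) (r : Request n) (x : Fin n → ℝ) :
    History.load (h ++ [(r, x)]) = h.load + x := by
  simp [History.load]

theorem Policy.loadFrom_nonneg {n : ℕ} (A : Policy n) (h : History n) (E : List (Request n))
    (i : Fin n) : 0 ≤ A.loadFrom h E i := by
  induction E generalizing h with
  | nil => simp [Policy.loadFrom]
  | cons r E ih => exact add_nonneg ((A.alloc_feasible h r).1 i) (ih _)

theorem waterFilling_isWaterFilling {n : ℕ} (h : History n) (r : Request n) :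
    r.IsWaterFilling h.load ((waterFilling n).alloc h r) :=
  Classical.choose_spec (r.exists_isWaterFilling h.load)

/-- The bounds for single requests telescope. Loads only grow, so a final level at most b bounds the
intermediate levels too. -/
theorem waterFilling_sum_le_from {n : ℕ} (h : History n) (E : List (Request n)) {y : Fin n → ℝ}
    (hy : y ∈ feasibleLoads E) (S : Finset (Fin n)) (b : ℝ)
    (hS : ∀ i ∈ S, h.load i + (waterFilling n).loadFrom h E i ≤ b) :
    ∑ i ∈ S, y i ≤
      ∑ i, (min b (h.load i + (waterFilling n).loadFrom h E i) - min b (h.load i)) := by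
  induction E generalizing h y with
  | nil =>
    have hy0 : y = 0 := by simpa [feasibleLoads] using hy
    simp [hy0, Policy.loadFrom]
  | cons r E ih =>
    rw [feasibleLoads, List.map_cons, List.sum_cons] at hy
    obtain ⟨y₁, hy₁, y₂, hy₂, rfl⟩ := Set.mem_add.1 hy
    set x := (waterFilling n).alloc h r with hx
    set h' : History n := h ++ [(r, x)] with hh'
    have hl : ∀ i, h'.load i = h.load i + x i := fun i => by
      rw [hh', History.load_append_singleton]; rfl
    have hL : ∀ i, (waterFilling n).loadFrom h (r :: E) i
        = x i + (waterFilling n).loadFrom h' E i := fun i => rfl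
    simp only [hL, ← add_assoc, ← hl] at hS ⊢
    have h2 := ih h' hy₂ hS
    have h1 := (waterFilling_isWaterFilling h r).sum_le hy₁ S b fun i hi => by
      have := hS i hi
      have := (waterFilling n).loadFrom_nonneg h' E i
      rw [← hx, ← hl]
      linarith
    rw [← hx] at h1
    simp only [← hl] at h1
    simp only [Pi.add_apply, Finset.sum_add_distrib, Finset.sum_sub_distrib] at h1 h2 ⊢
    linarith

theorem waterFilling_sum_le {n : ℕ} (E : List (Request n)) {y : Fin n → ℝ}
    (hy : y ∈ feasibleLoads E) {b : ℝ} (hb : 0 ≤ b) (S : Finset (Fin n))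
    (hS : ∀ i ∈ S, (waterFilling n).load E i ≤ b) :
    ∑ i ∈ S, y i ≤ ∑ i, min b ((waterFilling n).load E i) := by
  have := waterFilling_sum_le_from [] E hy S b (by simpa [History.load, Policy.load] using hS)
  simpa [History.load, Policy.load, hb] using this

theorem Policy.exists_mem_feasibleLoads {n : ℕ} (A : Policy n) (h : History n)
    (E : List (Request n)) : A.loadFrom h E ∈ feasibleLoads E := by
  induction E generalizing h with
  | nil => simp [feasibleLoads, Policy.loadFrom]
  | cons r E ih =>
    rw [feasibleLoads, List.map_cons, List.sum_cons]
    exact Set.add_mem_add (A.alloc_feasible h r) (ih _)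

/-! ### Harmonic numbers and the comparison function -/

theorem harmonic_real_succ (k : ℕ) :
    (harmonic (k + 1) : ℝ) = harmonic k + 1 / ((k : ℝ) + 1) := by
  rw [harmonic_succ]; push_cast; rw [one_div]

theorem harmonic_real_strictMono : StrictMono fun k : ℕ => (harmonic k : ℝ) :=
  strictMono_nat_of_lt_succ fun k => by
    rw [harmonic_real_succ]
    have : (0 : ℝ) < 1 / ((k : ℝ) + 1) := by positivity
    linarith

theorem harmonic_real_nonneg (k : ℕ) : (0 : ℝ) ≤ harmonic k := by
  have := harmonic_real_strictMono.monotone (Nat.zero_le k)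
  simpa using this

/-- Each step k → k + 1 adds 1/(k+1) to k old terms and creates one new term 1/(k+1). This yields
the value k of `harmonicInv` at H_k. -/
theorem sum_harmonic_sub (k : ℕ) :
    ∑ i ∈ Finset.range k, ((harmonic k : ℝ) - harmonic i) = k := by
  induction k with
  | zero => simp
  | succ k ih =>
    rw [Finset.sum_range_succ]
    have : ∀ i : ℕ, (harmonic (k + 1) : ℝ) - harmonic i
        = ((harmonic k : ℝ) - harmonic i) + 1 / ((k : ℝ) + 1) := fun i => by
      rw [harmonic_real_succ]; ring
    simp only [this, Finset.sum_add_distrib, ih, Finset.sum_const, Finset.card_range]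
    have hk : (k : ℝ) + 1 ≠ 0 := by positivity
    push_cast
    rw [nsmul_eq_mul]
    field_simp
    ring

/-- The inverse function of the piecewise linear interpolation of the harmonic numbers
`harmonic 0, …, harmonic n`. -/
noncomputable def harmonicInv (n : ℕ) (y : ℝ) : ℝ :=
  ∑ i ∈ Finset.range n, max 0 (y - (harmonic i : ℝ))

theorem harmonicInv_continuous (n : ℕ) : Continuous (harmonicInv n) := by
  unfold harmonicInv; fun_prop

theorem harmonicInv_mono (n : ℕ) : Monotone (harmonicInv n) := fun a b hab =>
  Finset.sum_le_sum fun i _ => max_le_max le_rfl (by linarith)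

theorem harmonicInv_nonneg (n : ℕ) (y : ℝ) : 0 ≤ harmonicInv n y :=
  Finset.sum_nonneg fun _ _ => le_max_left _ _

theorem sum_range_eq_of_harmonic_le {n k : ℕ} (hk : k ≤ n) {f : ℝ → ℝ} (hf : ∀ x ≤ 0, f x = 0)
    {y : ℝ} (hy : y ≤ harmonic k) :
    ∑ i ∈ Finset.range n, f (y - (harmonic i : ℝ))
      = ∑ i ∈ Finset.range k, f (y - (harmonic i : ℝ)) := by
  refine (Finset.sum_subset (Finset.range_mono hk) fun i _ hi => hf _ ?_).symm
  have : (harmonic k : ℝ) ≤ harmonic i :=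
    harmonic_real_strictMono.monotone (by simpa using hi)
  linarith

theorem harmonicInv_harmonic {n k : ℕ} (hk : k ≤ n) : harmonicInv n (harmonic k : ℝ) = k := by
  rw [harmonicInv, sum_range_eq_of_harmonic_le hk (fun x hx => max_eq_left hx) le_rfl]
  rw [← sum_harmonic_sub k]
  refine Finset.sum_congr rfl fun i hi => max_eq_right (sub_nonneg.2 ?_)
  exact harmonic_real_strictMono.monotone (Finset.mem_range.1 hi).le

/-- Up to the `m`-th harmonic number the slope of `harmonicInv` is at most `m`. -/
theorem harmonicInv_sub_le {n m : ℕ} {y d : ℝ} (hy : harmonicInv n y ≤ m) (hm : m ≤ n)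
    (hd : 0 ≤ d) : harmonicInv n y - m * d ≤ harmonicInv n (y - d) := by
  have hcard : harmonicInv n y - harmonicInv n (y - d)
      ≤ ∑ i ∈ Finset.range n, if i < m then d else 0 := by
    rw [harmonicInv, harmonicInv, ← Finset.sum_sub_distrib]
    refine Finset.sum_le_sum fun i hi => ?_
    split_ifs with him
    · have h1 := le_max_left 0 (y - d - (harmonic i : ℝ))
      have h2 := le_max_right 0 (y - d - (harmonic i : ℝ))
      have : max 0 (y - (harmonic i : ℝ)) ≤ max 0 (y - d - (harmonic i : ℝ)) + d :=
        max_le (by linarith) (by linarith)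
      linarith
    -- A summand with m ≤ i is inactive at y; otherwise y > H_m and `harmonicInv` would exceed m.
    · have hyi : y ≤ harmonic i := by
        by_contra! hlt
        have hmi : (harmonic m : ℝ) ≤ harmonic i :=
          harmonic_real_strictMono.monotone (not_lt.1 him)
        have hpos : harmonicInv n (harmonic m : ℝ) < harmonicInv n y := by
          refine Finset.sum_lt_sum (fun j _ => max_le_max le_rfl (by linarith)) ⟨i, hi, ?_⟩
          rw [max_eq_left (by linarith), max_eq_right (by linarith)]
          linarith
        rw [harmonicInv_harmonic hm] at hpos
        linarith
      rw [max_eq_left (by linarith), max_eq_left (by linarith), sub_zero]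
  rw [← Finset.sum_filter, Finset.sum_const, nsmul_eq_mul] at hcard
  have h2 : ((Finset.range n).filter (· < m)).card ≤ m := by
    calc _ ≤ (Finset.range m).card := Finset.card_le_card fun i hi => by simp_all
      _ = m := Finset.card_range m
  have h3 : (((Finset.range n).filter (· < m)).card : ℝ) * d ≤ m * d :=
    mul_le_mul_of_nonneg_right (by exact_mod_cast h2) hd
  linarith

theorem exists_harmonicInv_eq {n : ℕ} {a b : ℝ} (ha : 0 ≤ a) (hb : a ≤ harmonicInv n b) :
    ∃ y ≤ max 0 b, 0 ≤ y ∧ harmonicInv n y = a := by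
  have h0 : harmonicInv n 0 = 0 := by
    simpa using harmonicInv_harmonic (Nat.zero_le n)
  obtain ⟨y, hy, rfl⟩ := intermediate_value_Icc (le_max_left 0 b)
    (harmonicInv_continuous n).continuousOn
    (show a ∈ Set.Icc (harmonicInv n 0) (harmonicInv n (max 0 b)) from
      ⟨h0.symm ▸ ha, hb.trans (harmonicInv_mono n (le_max_right _ _))⟩)
  exact ⟨y, hy.2, hy.1, rfl⟩

/-- A discrete comparison principle for the total `∑ i, min b (L i)` as a function of the
level `b`. -/
theorem sub_sum_min_le_harmonicInv {n : ℕ} {L : Fin n → ℝ} (hL : ∀ i, 0 ≤ L i) {T p : ℝ}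
    (hp : harmonicInv n p = T)
    (hT : ∀ b, 0 ≤ b → T - ∑ i, min b (L i) ≤ (Finset.univ.filter fun i => b < L i).card)
    {b : ℝ} (hb : 0 ≤ b) : T - ∑ i, min b (L i) ≤ harmonicInv n (p - b) := by
  induction hN : (Finset.univ.filter fun i => L i < b).card using Nat.strong_induction_on
    generalizing b with
  | _ N ih =>
  rcases hb.eq_or_lt with rfl | hb
  · simp [hp, hL]
  -- b₀ is the last breakpoint before b: the largest load below b, or 0 if there is none. On [b₀, b]
  -- the total is affine with slope m.
  obtain ⟨b₀, hb₀, hb₀b, hgap, hP⟩ : ∃ b₀, 0 ≤ b₀ ∧ b₀ < b ∧ (∀ i, L i < b → L i ≤ b₀) ∧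
      T - ∑ i, min b₀ (L i) ≤ harmonicInv n (p - b₀) := by
    rcases (Finset.univ.filter fun i => L i < b).eq_empty_or_nonempty with he | hne
    · refine ⟨0, le_rfl, hb, fun i hi => ?_, by simp [hp, hL]⟩
      have : i ∈ Finset.univ.filter fun i => L i < b := by simpa using hi
      simp [he] at this
    · obtain ⟨j, hj, hmax⟩ := Finset.exists_max_image _ L hne
      have hjb : L j < b := by simpa using hj
      refine ⟨L j, hL j, hjb, fun i hi => hmax i (by simpa using hi), ih _ ?_ (hL j) rfl⟩
      rw [← hN]
      refine Finset.card_lt_card ⟨fun i hi => ?_, fun hsub => ?_⟩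
      · simp only [Finset.mem_filter, Finset.mem_univ, true_and] at hi ⊢
        exact hi.trans hjb
      · have := hsub hj
        simp at this
  set m := (Finset.univ.filter fun i => b₀ < L i).card with hm
  have hstep : ∑ i, min b (L i) = ∑ i, min b₀ (L i) + m * (b - b₀) := by
    rw [hm, ← nsmul_eq_mul, ← Finset.sum_const, Finset.sum_filter, ← Finset.sum_add_distrib]
    refine Finset.sum_congr rfl fun i _ => ?_
    split_ifs with hi
    · have : b ≤ L i := by
        by_contra! hlt
        exact absurd (hgap i hlt) (not_le.2 hi)
      rw [min_eq_left this, min_eq_left hi.le]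
      ring
    · rw [min_eq_right (by linarith), min_eq_right (by linarith), add_zero]
  have hmn : m ≤ n := (Finset.card_le_univ _).trans_eq (Fintype.card_fin n)
  rw [hstep, ← sub_sub]
  rcases le_or_gt (T - ∑ i, min b₀ (L i) - m * (b - b₀)) 0 with hneg | hpos
  · exact hneg.trans (harmonicInv_nonneg _ _)
  have hmd : 0 ≤ (m : ℝ) * (b - b₀) := mul_nonneg (Nat.cast_nonneg _) (by linarith)
  -- y is where `harmonicInv` equals the remainder at b₀. This value is at most m, so moving left by
  -- b - b₀ costs at most m * (b - b₀).
  obtain ⟨y, hy, hy0, hye⟩ := exists_harmonicInv_eq (by linarith) hP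
  have hpb : 0 ≤ p - b₀ := by
    by_contra! hlt
    have : harmonicInv n (p - b₀) ≤ harmonicInv n (harmonic 0 : ℝ) :=
      harmonicInv_mono n (by simpa using hlt.le)
    rw [harmonicInv_harmonic (Nat.zero_le n)] at this
    push_cast at this
    linarith
  rw [max_eq_right hpb] at hy
  have h1 := harmonicInv_sub_le (d := b - b₀) (hye.le.trans (hT b₀ hb₀)) hmn (by linarith)
  rw [hye] at h1
  exact h1.trans (harmonicInv_mono n (by linarith))

/-! ### Unit increments of the comparison function -/

theorem mul_matchingSeq {k : ℕ} (hk : 1 ≤ k) :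
    k * matchingSeq k = ∑ i ∈ Finset.range k, min 1 ((harmonic k : ℝ) - (harmonic i : ℝ)) := by
  have : (k : ℝ) ≠ 0 := by positivity
  rw [matchingSeq, Finset.sum_range_succ]
  simp only [sub_self, zero_le_one, min_eq_right, add_zero]
  field_simp

theorem matchingSeq_pos {k : ℕ} (hk : 1 ≤ k) : 0 < matchingSeq k := by
  have hk' : (0 : ℝ) < k := by positivity
  have h : 0 < k * matchingSeq k := by
    rw [mul_matchingSeq hk]
    refine Finset.sum_pos (fun i hi => lt_min one_pos (sub_pos.2 ?_)) ⟨0, Finset.mem_range.2 hk⟩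
    exact harmonic_real_strictMono (Finset.mem_range.1 hi)
  exact (mul_pos_iff_of_pos_left hk').1 h

/-- The increments of `harmonicInv` over unit intervals, by concavity between consecutive harmonic
numbers. -/
theorem le_harmonicInv_sub {n : ℕ} {ρ : ℝ} (hρ : ∀ k, 1 ≤ k → k ≤ n → ρ ≤ matchingSeq k)
    {p : ℝ} (hp0 : 0 ≤ p) (hpn : p ≤ harmonic n) :
    ρ * harmonicInv n p ≤ harmonicInv n p - harmonicInv n (p - 1) := by
  -- The unit increment of x ↦ max 0 x. It vanishes for x ≤ 0, so sums can be cut at k, and equals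
  -- the concave min 1 x for x ≥ 0.
  set g : ℝ → ℝ := fun x => min 1 (max 0 x) with hg
  have hg0 : ∀ x ≤ 0, g x = 0 := fun x hx => by simp [hg, hx]
  have hsub : harmonicInv n p - harmonicInv n (p - 1)
      = ∑ i ∈ Finset.range n, g (p - harmonic i) := by
    rw [harmonicInv, harmonicInv, ← Finset.sum_sub_distrib]
    refine Finset.sum_congr rfl fun i _ => ?_
    simp only [hg]
    rcases le_total (p - (harmonic i : ℝ)) 0 with h | h
    · rw [max_eq_left h, max_eq_left (by linarith)]; simp
    rw [max_eq_right h]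
    rcases le_total (p - (harmonic i : ℝ)) 1 with h' | h'
    · rw [max_eq_left (by linarith), min_eq_right h', sub_zero]
    · rw [max_eq_right (by linarith), min_eq_left h']; ring
  have hK : ∀ k ≤ n, ρ * k ≤ ∑ i ∈ Finset.range k, g (harmonic k - harmonic i) := by
    intro k hk
    rcases Nat.eq_zero_or_pos k with rfl | hk1
    · simp
    rw [mul_comm]
    refine (mul_le_mul_of_nonneg_left (hρ k hk1 hk) (Nat.cast_nonneg k)).trans ?_
    rw [mul_matchingSeq hk1]
    exact Finset.sum_le_sum fun i _ => min_le_min_left _ (le_max_right _ _)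
  rw [hsub]
  rcases hpn.eq_or_lt with rfl | hpn
  · rw [harmonicInv_harmonic le_rfl]; exact hK n le_rfl
  have hex : ∃ k, p < harmonic k := ⟨n, hpn⟩
  obtain ⟨k, hk⟩ : ∃ k, Nat.find hex = k + 1 := by
    refine Nat.exists_eq_succ_of_ne_zero fun h => ?_
    have := Nat.find_spec hex
    rw [h] at this
    simp only [harmonic_zero, Rat.cast_zero] at this
    linarith
  have hpk1 : p < harmonic (k + 1) := hk ▸ Nat.find_spec hex
  have hpk : (harmonic k : ℝ) ≤ p := not_lt.1 (Nat.find_min hex (by omega))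
  have hkn : k + 1 ≤ n := hk ▸ Nat.find_min' hex hpn
  have hΔ : (0 : ℝ) < harmonic (k + 1) - harmonic k := by linarith
  set θ := (p - harmonic k) / ((harmonic (k + 1) : ℝ) - harmonic k) with hθ
  have hθ0 : 0 ≤ θ := div_nonneg (by linarith) hΔ.le
  have hθ1 : θ ≤ 1 := (div_le_one hΔ).2 (by linarith)
  have hpθ : p = (1 - θ) * harmonic k + θ * harmonic (k + 1) := by
    have : θ * ((harmonic (k + 1) : ℝ) - harmonic k) = p - harmonic k :=
      div_mul_cancel₀ _ hΔ.ne'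
    linarith
  have hle : ∀ i ∈ Finset.range (k + 1), (harmonic i : ℝ) ≤ harmonic k := fun i hi =>
    harmonic_real_strictMono.monotone (Nat.lt_succ_iff.1 (Finset.mem_range.1 hi))
  have haff : ∀ f : ℝ → ℝ, (∀ x ≤ 0, f x = 0) → ∀ y ≤ (harmonic (k + 1) : ℝ),
      ∑ i ∈ Finset.range n, f (y - (harmonic i : ℝ))
        = ∑ i ∈ Finset.range (k + 1), f (y - (harmonic i : ℝ)) := fun f hf y hy =>
    sum_range_eq_of_harmonic_le hkn hf hy
  -- `harmonicInv` is affine on [H_k, H_{k+1}], so only the increment side needs concavity.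
  have hT : harmonicInv n p = (1 - θ) * k + θ * (k + 1 : ℕ) := by
    rw [← harmonicInv_harmonic (n := n) (k := k) (by omega), ← harmonicInv_harmonic hkn]
    simp only [harmonicInv]
    rw [haff _ (fun x hx => max_eq_left hx) p hpk1.le,
      haff _ (fun x hx => max_eq_left hx) _ (by linarith),
      haff _ (fun x hx => max_eq_left hx) _ le_rfl, Finset.mul_sum, Finset.mul_sum,
      ← Finset.sum_add_distrib]
    refine Finset.sum_congr rfl fun i hi => ?_
    have := hle i hi
    rw [max_eq_right (by linarith), max_eq_right (by linarith), max_eq_right (by linarith), hpθ]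
    ring
  have h1 := hK k (by omega)
  have h2 := hK (k + 1) hkn
  rw [hT, haff g hg0 p hpk1.le]
  calc ρ * ((1 - θ) * k + θ * (k + 1 : ℕ))
      = (1 - θ) * (ρ * k) + θ * (ρ * (k + 1 : ℕ)) := by ring
    _ ≤ (1 - θ) * ∑ i ∈ Finset.range (k + 1), g (harmonic k - harmonic i)
        + θ * ∑ i ∈ Finset.range (k + 1), g (harmonic (k + 1) - harmonic i) := by
      refine add_le_add (mul_le_mul_of_nonneg_left ?_ (by linarith))
        (mul_le_mul_of_nonneg_left h2 hθ0)
      rw [Finset.sum_range_succ, sub_self, hg0 0 le_rfl, add_zero]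
      exact h1
    _ ≤ ∑ i ∈ Finset.range (k + 1), g (p - harmonic i) := by
      rw [Finset.mul_sum, Finset.mul_sum, ← Finset.sum_add_distrib]
      refine Finset.sum_le_sum fun i hi => ?_
      have := hle i hi
      simp only [hg]
      rw [max_eq_right (by linarith), max_eq_right (by linarith), max_eq_right (by linarith)]
      set u := (harmonic k : ℝ) - harmonic i
      set v := (harmonic (k + 1) : ℝ) - harmonic i
      have hpu : p - harmonic i = (1 - θ) * u + θ * v := by rw [hpθ]; ring
      rw [hpu]
      refine le_min ?_ ?_
      · have a1 := mul_le_mul_of_nonneg_left (min_le_left 1 u) (show 0 ≤ 1 - θ by linarith)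
        have a2 := mul_le_mul_of_nonneg_left (min_le_left 1 v) hθ0
        linarith
      · have a1 := mul_le_mul_of_nonneg_left (min_le_right 1 u) (show 0 ≤ 1 - θ by linarith)
        have a2 := mul_le_mul_of_nonneg_left (min_le_right 1 v) hθ0
        linarith

theorem mul_le_sum_min_one {n : ℕ} {ρ : ℝ} (hρ : ∀ k, 1 ≤ k → k ≤ n → ρ ≤ matchingSeq k)
    {L : Fin n → ℝ} (hL : ∀ i, 0 ≤ L i) {T : ℝ} (hT0 : 0 ≤ T) (hTn : T ≤ n)
    (hT : ∀ b, 0 ≤ b → T - ∑ i, min b (L i) ≤ (Finset.univ.filter fun i => b < L i).card) :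
    ρ * T ≤ ∑ i, min 1 (L i) := by
  obtain ⟨p, hpn, hp0, rfl⟩ := exists_harmonicInv_eq (b := (harmonic n : ℝ)) hT0
    (by rwa [harmonicInv_harmonic le_rfl])
  rw [max_eq_right (harmonic_real_nonneg n)] at hpn
  have h1 := sub_sum_min_le_harmonicInv hL rfl hT zero_le_one
  have h2 := le_harmonicInv_sub hρ hp0 hpn
  linarith

/-! ### Competitiveness of water-filling -/

theorem Policy.load_nonneg {n : ℕ} (A : Policy n) (E : List (Request n)) (i : Fin n) :
    0 ≤ A.load E i :=
  A.loadFrom_nonneg [] E i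

theorem feasibleLoads_nonneg {n : ℕ} {E : List (Request n)} {y : Fin n → ℝ}
    (hy : y ∈ feasibleLoads E) (i : Fin n) : 0 ≤ y i := by
  induction E generalizing y with
  | nil =>
    have hy0 : y = 0 := by simpa [feasibleLoads] using hy
    simp [hy0]
  | cons r E ih =>
    rw [feasibleLoads, List.map_cons, List.sum_cons] at hy
    obtain ⟨y₁, hy₁, y₂, hy₂, rfl⟩ := Set.mem_add.1 hy
    exact add_nonneg (hy₁.1 i) (ih hy₂)

theorem fractionalMatching_le {n : ℕ} (c : ℝ) (x : Fin n → ℝ) :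
    fractionalMatching c x ≤ n * c := by
  refine (Finset.sum_le_sum fun i _ => min_le_left c (x i)).trans_eq ?_
  simp

theorem fractionalMatching_nonneg {n : ℕ} {c : ℝ} (hc : 0 ≤ c) {x : Fin n → ℝ}
    (hx : ∀ i, 0 ≤ x i) : 0 ≤ fractionalMatching c x :=
  Finset.sum_nonneg fun i _ => le_min hc (hx i)

theorem le_hindsightValue {n : ℕ} (c : ℝ) {E : List (Request n)} {y : Fin n → ℝ}
    (hy : y ∈ feasibleLoads E) :
    fractionalMatching c y ≤ hindsightValue (fractionalMatching c) E :=
  le_csSup ⟨n * c, by rintro _ ⟨x, -, rfl⟩; exact fractionalMatching_le c x⟩ ⟨y, hy, rfl⟩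

theorem mul_le_fractionalMatching_waterFilling {n : ℕ} {c ρ : ℝ} (hc : 0 < c)
    (hρ : ∀ k, 1 ≤ k → k ≤ n → ρ ≤ matchingSeq k) {E : List (Request n)} {y : Fin n → ℝ}
    (hy : y ∈ feasibleLoads E) :
    ρ * fractionalMatching c y ≤ fractionalMatching c ((waterFilling n).load E) := by
  set L := (waterFilling n).load E
  have hscale : ∀ b x : ℝ, c * min b (x / c) = min (c * b) x := fun b x => by
    rw [mul_min_of_nonneg _ _ hc.le, mul_div_cancel₀ _ hc.ne']
  have hy0 := feasibleLoads_nonneg hy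
  have key := mul_le_sum_min_one hρ (L := fun i => L i / c) (T := ∑ i, min 1 (y i / c))
    (fun i => div_nonneg ((waterFilling n).load_nonneg E i) hc.le)
    (Finset.sum_nonneg fun i _ => le_min zero_le_one (div_nonneg (hy0 i) hc.le))
    ((Finset.sum_le_sum fun i _ => min_le_left _ _).trans_eq (by simp)) ?_
  · have := mul_le_mul_of_nonneg_left key hc.le
    have hfm : ∀ z : Fin n → ℝ, c * ∑ i, min 1 (z i / c) = fractionalMatching c z := fun z => by
      simp only [Finset.mul_sum, hscale, mul_one, fractionalMatching]
    rwa [mul_left_comm, hfm, hfm] at this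
  intro b hb
  -- Nodes at level at most b are controlled by water-filling, the others by the truncation of y at
  -- 1.
  have h1 := waterFilling_sum_le E hy (mul_nonneg hc.le hb)
    (Finset.univ.filter fun i => ¬ b < L i / c) fun i hi => by
      have : L i / c ≤ b := by simpa using hi
      rw [mul_comm]
      exact (div_le_iff₀ hc).1 this
  have h2 : ∑ i ∈ Finset.univ.filter fun i => ¬ b < L i / c, min 1 (y i / c)
      ≤ ∑ i, min b (L i / c) := by
    refine le_of_mul_le_mul_left ?_ hc
    rw [Finset.mul_sum, Finset.mul_sum]
    simp only [hscale]
    exact (Finset.sum_le_sum fun i _ => min_le_right _ _).trans h1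
  have h3 : ∑ i ∈ Finset.univ.filter fun i => b < L i / c, min 1 (y i / c)
      ≤ (Finset.univ.filter fun i => b < L i / c).card :=
    (Finset.sum_le_sum fun i _ => min_le_left _ _).trans_eq (by simp)
  rw [← Finset.sum_filter_add_sum_filter_not Finset.univ (fun i => b < L i / c)]
  linarith

theorem RandomizedPolicy.regret_nonpos_iff {n : ℕ} (A : RandomizedPolicy n)
    (f : (Fin n → ℝ) → ℝ) (α : ℝ) :
    A.regret f α ≤ 0 ↔ ∀ E : List (Request n), E ≠ [] →
      α * hindsightValue f E ≤ ∫ ω, f ((A.policy ω).load E) ∂A.law := by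
  simp only [RandomizedPolicy.regret, iSup_le_iff, RandomizedPolicy.cost]
  refine forall₂_congr fun E _ => ?_
  rw [← EReal.coe_zero, EReal.coe_le_coe_iff, sub_nonpos]

theorem waterFilling_mem_competitiveFactors {n : ℕ} {c ρ : ℝ} (hc : 0 < c) (hρ0 : 0 < ρ)
    (hρ : ∀ k, 1 ≤ k → k ≤ n → ρ ≤ matchingSeq k) :
    ρ ∈ (waterFilling n).toRandomized.competitiveFactors (fractionalMatching c) := by
  refine ⟨hρ0, (RandomizedPolicy.regret_nonpos_iff _ _ _).2 fun E _ => ?_⟩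
  have hint : ∫ ω, fractionalMatching c (((waterFilling n).toRandomized.policy ω).load E)
      ∂(waterFilling n).toRandomized.law = fractionalMatching c ((waterFilling n).load E) :=
    MeasureTheory.integral_dirac (α := Unit)
      (fun _ => fractionalMatching c ((waterFilling n).load E)) ()
  rw [hint, mul_comm, ← le_div_iff₀ hρ0]
  refine csSup_le (Set.Nonempty.image _ ⟨_, (waterFilling n).exists_mem_feasibleLoads [] E⟩) ?_
  rintro _ ⟨y, hy, rfl⟩
  rw [le_div_iff₀ hρ0, mul_comm]
  exact mul_le_fractionalMatching_waterFilling hc hρ hy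

/-! ### Upper triangular instances in random order -/

/-- The history of a policy on `E`, started from the history `h`. -/
def Policy.run {n : ℕ} (A : Policy n) (h : History n) (E : List (Request n)) : History n :=
  E.foldl (fun h r => h ++ [(r, A.alloc h r)]) h

theorem Policy.loadFrom_append_singleton {n : ℕ} (A : Policy n) (h : History n)
    (E : List (Request n)) (r : Request n) :
    A.loadFrom h (E ++ [r]) = A.loadFrom h E + A.alloc (A.run h E) r := by
  induction E generalizing h with
  | nil => simp [Policy.loadFrom, Policy.run]
  | cons s E ih =>
    simp only [List.cons_append, Policy.loadFrom, ih, add_assoc]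
    rfl

/-- The positions `t, …, k - 1` (and always `k - 1`). -/
def tailPositions (n k t : ℕ) : Finset (Fin n) :=
  Finset.univ.filter fun j => (j : ℕ) < k ∧ (t ≤ j ∨ (j : ℕ) + 1 = k)

theorem tailPositions_nonempty {n k : ℕ} (hk : 1 ≤ k) (hkn : k ≤ n) (t : ℕ) :
    (tailPositions n k t).Nonempty :=
  ⟨⟨k - 1, by omega⟩, by simp [tailPositions]; omega⟩

theorem mem_tailPositions {n k t : ℕ} (ht : t < k) {j : Fin n} :
    j ∈ tailPositions n k t ↔ t ≤ j ∧ (j : ℕ) < k := by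
  simp only [tailPositions, Finset.mem_filter, Finset.mem_univ, true_and]
  omega

/-- The request of the upper triangular instance with node order `σ` at time `t < k`. -/
noncomputable def triangularRequest {n k : ℕ} (hk : 1 ≤ k) (hkn : k ≤ n) {c : ℝ} (hc : 0 < c)
    (σ : Equiv.Perm (Fin n)) (t : ℕ) : Request n where
  nbrs := (tailPositions n k t).map σ.toEmbedding
  nonempty := (tailPositions_nonempty hk hkn t).map
  quantity := c
  quantity_pos := hc

/-- The first `t` requests of the upper triangular instance. -/
noncomputable def triangularSeq {n k : ℕ} (hk : 1 ≤ k) (hkn : k ≤ n) {c : ℝ} (hc : 0 < c)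
    (σ : Equiv.Perm (Fin n)) : ℕ → List (Request n)
  | 0 => []
  | t + 1 => triangularSeq hk hkn hc σ t ++ [triangularRequest hk hkn hc σ t]

section Triangular

variable {n k : ℕ} (hk : 1 ≤ k) (hkn : k ≤ n) {c : ℝ} (hc : 0 < c)

theorem triangularRequest_mul_swap (σ : Equiv.Perm (Fin n)) {t s : ℕ} {i j : Fin n} (hts : t ≤ s)
    (hi : s ≤ i ∧ (i : ℕ) < k) (hj : s ≤ j ∧ (j : ℕ) < k) :
    triangularRequest hk hkn hc (σ * Equiv.swap i j) t = triangularRequest hk hkn hc σ t := by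
  have ht : t < k := by omega
  have : (tailPositions n k t).map (σ * Equiv.swap i j).toEmbedding
      = (tailPositions n k t).map σ.toEmbedding := by
    ext a
    simp only [Finset.mem_map_equiv, mem_tailPositions ht, Equiv.Perm.mul_def,
      Equiv.symm_trans_apply, Equiv.symm_swap]
    rw [Equiv.swap_apply_def]
    split_ifs with h1 h2
    · rw [h1]; omega
    · rw [h2]; omega
    · rfl
  simp only [triangularRequest, this]

theorem triangularSeq_mul_swap (σ : Equiv.Perm (Fin n)) {t s : ℕ} {i j : Fin n} (hts : t ≤ s)
    (hi : s ≤ i ∧ (i : ℕ) < k) (hj : s ≤ j ∧ (j : ℕ) < k) :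
    triangularSeq hk hkn hc (σ * Equiv.swap i j) t = triangularSeq hk hkn hc σ t := by
  induction t with
  | zero => rfl
  | succ t ih =>
    simp only [triangularSeq]
    rw [ih (by omega), triangularRequest_mul_swap hk hkn hc σ (by omega) hi hj]

/-- The allocation of a policy at time `t` of the upper triangular instance. -/
noncomputable def Policy.triangularAlloc (A : Policy n) (σ : Equiv.Perm (Fin n)) (t : ℕ) :
    Fin n → ℝ :=
  A.alloc (A.run [] (triangularSeq hk hkn hc σ t)) (triangularRequest hk hkn hc σ t)

theorem Policy.load_triangularSeq (A : Policy n) (σ : Equiv.Perm (Fin n)) (t : ℕ) (i : Fin n) :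
    A.load (triangularSeq hk hkn hc σ t) i
      = ∑ s ∈ Finset.range t, A.triangularAlloc hk hkn hc σ s i := by
  induction t with
  | zero => simp [triangularSeq, Policy.load, Policy.loadFrom]
  | succ t ih =>
    rw [Finset.sum_range_succ, ← ih, Policy.load, triangularSeq,
      Policy.loadFrom_append_singleton]
    rfl

/-- Requests 0, …, t do not reveal the order of the positions t, …, k - 1. Averaged over σ, these k
- t positions therefore get equal shares of c. -/
theorem Policy.sum_perm_triangularAlloc (A : Policy n) {t : ℕ} {j : Fin n} (htj : t ≤ j)
    (hj : (j : ℕ) < k) :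
    ∑ σ : Equiv.Perm (Fin n), A.triangularAlloc hk hkn hc σ t (σ j)
      = (n.factorial : ℝ) * (c / ((k : ℝ) - t)) := by
  have htk : t < k := by omega
  let i : Fin n := ⟨t, by omega⟩
  have hsymm : ∀ j' ∈ tailPositions n k t,
      ∑ σ : Equiv.Perm (Fin n), A.triangularAlloc hk hkn hc σ t (σ j')
        = ∑ σ : Equiv.Perm (Fin n), A.triangularAlloc hk hkn hc σ t (σ i) := by
    intro j' hj'
    rw [mem_tailPositions htk] at hj'
    -- Reindexing by this swap leaves everything the policy has seen unchanged and exchanges the two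
    -- positions.
    rw [← Equiv.sum_comp (Equiv.mulRight (Equiv.swap i j'))]
    refine Finset.sum_congr rfl fun σ _ => ?_
    have hi : t ≤ (i : ℕ) ∧ (i : ℕ) < k := ⟨le_rfl, htk⟩
    simp only [Equiv.coe_mulRight, Policy.triangularAlloc,
      triangularSeq_mul_swap hk hkn hc σ le_rfl hi hj',
      triangularRequest_mul_swap hk hkn hc σ le_rfl hi hj', Equiv.Perm.mul_apply,
      Equiv.swap_apply_right]
  have htotal : ∀ σ : Equiv.Perm (Fin n),
      ∑ j' ∈ tailPositions n k t, A.triangularAlloc hk hkn hc σ t (σ j') = c := by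
    intro σ
    have hf := A.alloc_feasible (A.run [] (triangularSeq hk hkn hc σ t))
      (triangularRequest hk hkn hc σ t)
    have hsum : ∑ a, A.triangularAlloc hk hkn hc σ t a = c := hf.2.2
    have hsub := Finset.sum_subset (Finset.subset_univ (triangularRequest hk hkn hc σ t).nbrs)
      (f := A.triangularAlloc hk hkn hc σ t) fun a _ ha => hf.2.1 a ha
    rw [← hsub] at hsum
    exact (Finset.sum_map _ _ _).symm.trans hsum
  have hcard : ((tailPositions n k t).card : ℝ) = (k : ℝ) - t := by
    have : (tailPositions n k t).map Fin.valEmbedding = Finset.Ico t k := by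
      ext a
      simp only [Finset.mem_map, mem_tailPositions htk, Fin.valEmbedding_apply, Finset.mem_Ico]
      exact ⟨by rintro ⟨b, hb, rfl⟩; exact hb, fun ha => ⟨⟨a, by omega⟩, ha, rfl⟩⟩
    rw [← Finset.card_map Fin.valEmbedding, this, Nat.card_Ico, Nat.cast_sub htk.le]
  have hpos : (0 : ℝ) < (k : ℝ) - t := sub_pos.2 (by exact_mod_cast htk)
  rw [hsymm j ((mem_tailPositions htk).2 ⟨htj, hj⟩), mul_div_assoc', eq_div_iff hpos.ne', ← hcard]
  rw [mul_comm, ← nsmul_eq_mul, ← Finset.sum_const, ← Finset.sum_congr rfl hsymm,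
    Finset.sum_comm]
  simp [htotal, Fintype.card_perm]

theorem Policy.triangularAlloc_eq_zero (A : Policy n) (σ : Equiv.Perm (Fin n)) {t : ℕ}
    {j : Fin n} (ht : t < k) (hj : ¬ (t ≤ j ∧ (j : ℕ) < k)) :
    A.triangularAlloc hk hkn hc σ t (σ j) = 0 := by
  refine (A.alloc_feasible _ _).2.1 _ fun h => hj ?_
  rw [← mem_tailPositions ht]
  simpa [triangularRequest] using h

theorem sum_range_one_div_sub (k : ℕ) {j : ℕ} (hj : j < k) :
    ∑ t ∈ Finset.range (j + 1), 1 / ((k : ℝ) - t)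
      = (harmonic k : ℝ) - (harmonic (k - 1 - j) : ℝ) := by
  induction j with
  | zero =>
    obtain ⟨k, rfl⟩ := Nat.exists_eq_succ_of_ne_zero (by omega : k ≠ 0)
    simp [harmonic_succ]
  | succ j ih =>
    rw [Finset.sum_range_succ, ih (by omega)]
    obtain ⟨m, rfl⟩ := Nat.exists_eq_add_of_lt hj
    rw [show j + 1 + m + 1 - 1 - j = m + 1 by omega,
      show j + 1 + m + 1 - 1 - (j + 1) = m by omega, harmonic_real_succ m]
    push_cast
    rw [show (j : ℝ) + 1 + m + 1 - (j + 1) = m + 1 by ring]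
    ring

theorem Policy.sum_perm_load_triangularSeq (A : Policy n) (j : Fin n) :
    ∑ σ : Equiv.Perm (Fin n), A.load (triangularSeq hk hkn hc σ k) (σ j)
      = if (j : ℕ) < k then
          (n.factorial : ℝ) * (c * ((harmonic k : ℝ) - (harmonic (k - 1 - j) : ℝ))) else 0 := by
  simp only [Policy.load_triangularSeq]
  rw [Finset.sum_comm]
  split_ifs with hj
  · rw [← sum_range_one_div_sub k hj, Finset.mul_sum, Finset.mul_sum]
    refine (Finset.sum_subset (Finset.range_mono (by omega : (j : ℕ) + 1 ≤ k))
      fun t ht htj => ?_).symm.trans (Finset.sum_congr rfl fun t ht => ?_)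
    · refine Finset.sum_eq_zero fun σ _ =>
        A.triangularAlloc_eq_zero hk hkn hc σ (Finset.mem_range.1 ht) fun h => htj ?_
      rw [Finset.mem_range]
      omega
    · have := Finset.mem_range.1 ht
      rw [A.sum_perm_triangularAlloc hk hkn hc (by omega) hj, mul_one_div]
  · exact Finset.sum_eq_zero fun t ht => Finset.sum_eq_zero fun σ _ =>
      A.triangularAlloc_eq_zero hk hkn hc σ (Finset.mem_range.1 ht) fun h => hj h.2

/-- Jensen's inequality for the concave min c, applied position by position to the averaged loads.
-/
theorem Policy.sum_perm_fractionalMatching_le (A : Policy n) :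
    ∑ σ : Equiv.Perm (Fin n), fractionalMatching c (A.load (triangularSeq hk hkn hc σ k))
      ≤ (n.factorial : ℝ) * (c * (k * matchingSeq k)) := by
  have hfact : (0 : ℝ) ≤ n.factorial := Nat.cast_nonneg _
  have hterm : ∀ j : Fin n,
      ∑ σ : Equiv.Perm (Fin n), min c (A.load (triangularSeq hk hkn hc σ k) (σ j))
        ≤ if (j : ℕ) < k then (n.factorial : ℝ) *
            (c * min 1 ((harmonic k : ℝ) - (harmonic (k - 1 - j) : ℝ))) else 0 := by
    intro j
    have h1 : ∑ σ : Equiv.Perm (Fin n), min c (A.load (triangularSeq hk hkn hc σ k) (σ j))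
        ≤ n.factorial * c :=
      (Finset.sum_le_sum fun σ _ => min_le_left _ _).trans_eq (by simp [Fintype.card_perm])
    have h2 := (Finset.sum_le_sum fun (σ : Equiv.Perm (Fin n)) (_ : σ ∈ Finset.univ) =>
      min_le_right c (A.load (triangularSeq hk hkn hc σ k) (σ j))).trans_eq
        (A.sum_perm_load_triangularSeq hk hkn hc j)
    split_ifs at h2 ⊢ with hj
    · rw [mul_min_of_nonneg _ _ hc.le, mul_min_of_nonneg _ _ hfact, mul_one]
      exact le_min h1 h2
    · exact h2
  calc _ = ∑ σ : Equiv.Perm (Fin n), ∑ j,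
        min c (A.load (triangularSeq hk hkn hc σ k) (σ j)) :=
      Finset.sum_congr rfl fun σ _ =>
        (Equiv.sum_comp σ fun a => min c (A.load (triangularSeq hk hkn hc σ k) a)).symm
    _ ≤ ∑ j : Fin n, if (j : ℕ) < k then (n.factorial : ℝ) *
          (c * min 1 ((harmonic k : ℝ) - (harmonic (k - 1 - j) : ℝ))) else 0 := by
      rw [Finset.sum_comm]
      exact Finset.sum_le_sum fun j _ => hterm j
    _ = _ := by
      rw [Fin.sum_univ_eq_sum_range (fun j : ℕ => if j < k then (n.factorial : ℝ) *
          (c * min 1 ((harmonic k : ℝ) - (harmonic (k - 1 - j) : ℝ))) else 0) n,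
        -- The reflection turns the index k - 1 - j into the index of M_k.
        ← Finset.sum_filter, mul_matchingSeq hk, ← Finset.sum_range_reflect, Finset.mul_sum,
        Finset.mul_sum]
      refine Finset.sum_congr ?_ fun _ _ => rfl
      ext j
      simp only [Finset.mem_filter, Finset.mem_range]
      omega

/-- In hindsight each request s goes wholly to σ s, the node that no later request can use (for s <
k - 1). -/
theorem triangularSeq_mem_feasibleLoads (σ : Equiv.Perm (Fin n)) {t : ℕ} (ht : t ≤ k) :
    (fun a => if ((σ.symm a : Fin n) : ℕ) < t then c else 0)
      ∈ feasibleLoads (triangularSeq hk hkn hc σ t) := by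
  induction t with
  | zero =>
    simp only [Nat.not_lt_zero, if_false, triangularSeq, feasibleLoads, List.map_nil,
      List.sum_nil]
    exact rfl
  | succ t ih =>
    rw [triangularSeq, feasibleLoads, List.map_append, List.sum_append]
    let i : Fin n := ⟨t, by omega⟩
    have hi : Pi.single (σ i) c ∈ (triangularRequest hk hkn hc σ t).feasible := by
      refine ⟨fun a => ?_, fun a ha => ?_, by simp [triangularRequest]⟩
      · by_cases h : a = σ i
        · subst h; simpa using hc.le
        · simp [h]
      · have h : a ≠ σ i := by
          rintro rfl
          refine ha ?_
          simp only [triangularRequest, Finset.mem_map_equiv, Equiv.symm_apply_apply]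
          exact (mem_tailPositions ht).2 ⟨le_rfl, ht⟩
        simp [h]
    refine Set.mem_add.2 ⟨_, ih (by omega), Pi.single (σ i) c, by simpa using hi, ?_⟩
    ext a
    obtain ⟨b, rfl⟩ := σ.surjective a
    by_cases hb : b = i
    · subst hb; simp [i]
    · have hb' : (b : ℕ) ≠ t := fun h => hb (Fin.ext h)
      have : (b : ℕ) < t + 1 ↔ (b : ℕ) < t := by omega
      simp [hb, this]

theorem mul_le_hindsightValue_triangularSeq (σ : Equiv.Perm (Fin n)) :
    k * c ≤ hindsightValue (fractionalMatching c) (triangularSeq hk hkn hc σ k) := by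
  refine le_trans (le_of_eq ?_)
    (le_hindsightValue c (triangularSeq_mem_feasibleLoads hk hkn hc σ le_rfl))
  rw [fractionalMatching, ← Equiv.sum_comp σ]
  have : ∀ j : ℕ, min c (if j < k then c else 0) = if j < k then c else 0 := fun j => by
    split_ifs <;> simp [hc.le]
  simp only [Equiv.symm_apply_apply, this]
  rw [Fin.sum_univ_eq_sum_range (fun j : ℕ => if j < k then c else 0) n, ← Finset.sum_filter,
    show (Finset.range n).filter (· < k) = Finset.range k by
      ext; simp only [Finset.mem_filter, Finset.mem_range]; omega]
  simp

end Triangular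

/-! ### Randomized policies and the final result -/

theorem RandomizedPolicy.integrable_fractionalMatching {n : ℕ} (A : RandomizedPolicy n) {c : ℝ}
    (hc : 0 ≤ c) (E : List (Request n)) :
    MeasureTheory.Integrable (fun ω => fractionalMatching c ((A.policy ω).load E)) A.law := by
  refine MeasureTheory.Integrable.of_bound (C := n * c) ?_ (Filter.Eventually.of_forall fun ω => ?_)
  · have hf : Measurable (fractionalMatching c : (Fin n → ℝ) → ℝ) := by
      unfold fractionalMatching; fun_prop
    exact (hf.comp (A.measurable_load E)).aestronglyMeasurable
  · rw [Real.norm_of_nonneg (fractionalMatching_nonneg hc ((A.policy ω).load_nonneg E))]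
    exact fractionalMatching_le c _

/-- Yao's principle: sum the competitive guarantee over all σ, exchange the sum with the
expectation, and bound the sum for each fixed outcome of the coins. -/
theorem RandomizedPolicy.le_matchingSeq {n : ℕ} (A : RandomizedPolicy n) {c α : ℝ} (hc : 0 < c)
    (hα : α ∈ A.competitiveFactors (fractionalMatching c)) {k : ℕ} (hk : 1 ≤ k) (hkn : k ≤ n) :
    α ≤ matchingSeq k := by
  obtain ⟨hα0, hreg⟩ := hα
  rw [RandomizedPolicy.regret_nonpos_iff] at hreg
  have hne : ∀ σ, triangularSeq hk hkn hc σ k ≠ [] := fun σ => by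
    obtain ⟨m, rfl⟩ := Nat.exists_eq_succ_of_ne_zero (by omega : k ≠ 0)
    simp [triangularSeq]
  have hfact : (0 : ℝ) < n.factorial := by exact_mod_cast n.factorial_pos
  have hk0 : (0 : ℝ) < k := by exact_mod_cast hk
  have h : (n.factorial : ℝ) * (c * (k * α)) ≤ n.factorial * (c * (k * matchingSeq k)) := by
    calc (n.factorial : ℝ) * (c * (k * α)) = ∑ _σ : Equiv.Perm (Fin n), α * (k * c) := by
          simp only [Finset.sum_const, Finset.card_univ, Fintype.card_perm, Fintype.card_fin,
            nsmul_eq_mul]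
          ring
      _ ≤ ∑ σ : Equiv.Perm (Fin n), ∫ ω, fractionalMatching c
            ((A.policy ω).load (triangularSeq hk hkn hc σ k)) ∂A.law :=
          Finset.sum_le_sum fun σ _ => (mul_le_mul_of_nonneg_left
            (mul_le_hindsightValue_triangularSeq hk hkn hc σ) hα0.le).trans (hreg _ (hne σ))
      _ = ∫ ω, ∑ σ : Equiv.Perm (Fin n), fractionalMatching c
            ((A.policy ω).load (triangularSeq hk hkn hc σ k)) ∂A.law :=
          (MeasureTheory.integral_finsetSum _ fun σ _ =>
            A.integrable_fractionalMatching hc.le _).symm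
      _ ≤ ∫ _ω, (n.factorial : ℝ) * (c * (k * matchingSeq k)) ∂A.law :=
          MeasureTheory.integral_mono
            (MeasureTheory.integrable_finsetSum _ fun σ _ =>
              A.integrable_fractionalMatching hc.le _)
            (MeasureTheory.integrable_const _)
            fun ω => (A.policy ω).sum_perm_fractionalMatching_le hk hkn hc
      _ = _ := by simp
  exact le_of_mul_le_mul_left (le_of_mul_le_mul_left (le_of_mul_le_mul_left h hfact) hc) hk0

theorem mainTheorem12 (n : ℕ) (hn : 1 ≤ n) (c : ℝ) (hc : 0 < c) :
    (waterFilling n).toRandomized.IsCompetitiveRatio (fractionalMatching c)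
        ((Finset.Icc 1 n).inf' (Finset.nonempty_Icc.mpr hn) matchingSeq) ∧
      ∀ A : RandomizedPolicy n, ∀ α ∈ A.competitiveFactors (fractionalMatching c),
        α ≤ (Finset.Icc 1 n).inf' (Finset.nonempty_Icc.mpr hn) matchingSeq := by
  refine ⟨⟨waterFilling_mem_competitiveFactors hc ?_ fun k hk hkn => ?_, fun α hα => ?_⟩,
    fun A α hα => ?_⟩
  · exact (Finset.lt_inf'_iff _).2 fun k hk => matchingSeq_pos (Finset.mem_Icc.1 hk).1
  · exact Finset.inf'_le _ (Finset.mem_Icc.2 ⟨hk, hkn⟩)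
  · exact Finset.le_inf' _ _ fun k hk =>
      RandomizedPolicy.le_matchingSeq _ hc hα (Finset.mem_Icc.1 hk).1 (Finset.mem_Icc.1 hk).2
  · exact Finset.le_inf' _ _ fun k hk =>
      A.le_matchingSeq hc hα (Finset.mem_Icc.1 hk).1 (Finset.mem_Icc.1 hk).2
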